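/- Let $g,\lambda,B$ be real-valued functions on $\mathbb{N}$ such that $g$ is positive and increasing, $g(n)\to\infty$, $g(n)=o(n^{1/3})$, and, for all $n\ge 1$, $|\lambda(n)|\le g(n)$ and $B(n)\le n^{2/3}/g(n)^2$. Suppose also that $B(n)\to\infty$. Let $G\sim G\big(n,\frac{1+\lambda(n)n^{-1/3}}{n}\big)$ be the random graph on $n$ vertices in which each edge is present independently with probability $\frac{1+\lambda(n)n^{-1/3}}{n}$, and let $|S_B|$ denote the number of connected components of $G$ whose number of vertices lies in the interval $[B(n),2B(n)]$. Then there exist constants $\delta_1,\delta_2>0$, independent of $n$, such that $$\Pr\left[|S_B|\le \frac{\delta_1 n}{B(n)^{3/2}}\right]\le \frac{\delta_2 B(n)^{3/2}}{n}$$ for every $n\ge 1$ for which $B(n)>0$ and $0\le\frac{1+\lambda(n)n^{-1/3}}{n}\le 1$ (this holds for all sufficiently large $n$). -/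

import Mathlib

open Filter Asymptotics MeasureTheory

/-- The number of vertices in a connected component of a graph. -/
noncomputable def componentSize {V : Type*} {G : SimpleGraph V} (c : G.ConnectedComponent) : ℕ :=
  c.supp.ncard

/-- The set of connected components of `G` whose size lies in the real interval `[B, 2B]`. -/
def componentsInWindow {V : Type*} (G : SimpleGraph V) (B : ℝ) : Set G.ConnectedComponent :=
  {c | B ≤ (componentSize c : ℝ) ∧ (componentSize c : ℝ) ≤ 2 * B}

/-- The edge probability `(1 + l * n ^ (-1/3)) / n` in the critical window. -/
noncomputable def criticalEdgeProb (n : ℕ) (l : ℝ) : ℝ :=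
  (1 + l * (n : ℝ) ^ (-(1 / 3) : ℝ)) / n

/-! The proof is the second moment method. Write b for B(n), Y for the number of vertex sets with
size in [b, 2b] that are components, and M for the mean of Y.

First moment. A k-set is connected with probability at least k^(k-2) p^(k-1) (1-p)^C(k-1,2), by
Cayley's tree count. The count enters through breadth-first exploration: the probability that
exploration exhausts the set obeys a recursion, and the binomial theorem turns that recursion into
the tree bound (`le_exploreProb`). With Stirling's formula and p = (1+ε)/n, the expected number of
components of size k is at least a constant times n / k^(5/2) (`le_choose_mul_connectProb`). Summing
over about b sizes gives M of order at least n / b^(3/2) (`sum_window_ge`).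

Second moment. Distinct components are disjoint, so E[Y²] is M plus a sum over disjoint pairs. For
sizes j and k, conditioning on one component changes the expected count of the other by a factor at
most exp(jk(p + 2p² - 1/n)) (`choose_sub_mul_pow_le`). The terms p and 1/n nearly cancel. Since b ≤
n^(2/3)/g² and |λ| ≤ g force |ε|√b ≤ 1, the factor is 1 + O(b^(3/2)/n) (`window_exponent_le`).
Chebyshev's inequality then bounds Pr[Y ≤ M/2] by O(1/M + b^(3/2)/n) = O(b^(3/2)/n). -/

open Finset in
/-- The expectation of `f` at the random subset of `F` that contains each element independently
with probability `p`. -/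
def bernSum {E : Type*} (p : ℝ) (F : Finset E) (f : Finset E → ℝ) : ℝ :=
  ∑ s ∈ F.powerset, p ^ #s * (1 - p) ^ (#F - #s) * f s

/-! ### Expectations over random subsets of a finite set. -/

section BernSum

open Finset

variable {E : Type*} {p : ℝ} {F F' : Finset E} {f g : Finset E → ℝ}

theorem bernSum_congr (h : ∀ s ⊆ F, f s = g s) : bernSum p F f = bernSum p F g := by
  refine sum_congr rfl fun s hs => ?_
  rw [h s (mem_powerset.1 hs)]

theorem bernSum_mono (hp0 : 0 ≤ p) (hp1 : p ≤ 1) (h : ∀ s ⊆ F, f s ≤ g s) :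
    bernSum p F f ≤ bernSum p F g := by
  refine sum_le_sum fun s hs => ?_
  have := h s (mem_powerset.1 hs)
  have := sub_nonneg.2 hp1
  gcongr

theorem bernSum_const (c : ℝ) : bernSum p F (fun _ => c) = c := by
  rw [bernSum, ← sum_mul, sum_pow_mul_eq_add_pow]
  simp

theorem bernSum_mul_left (c : ℝ) : bernSum p F (fun s => c * f s) = c * bernSum p F f := by
  simp only [bernSum, mul_sum]
  exact sum_congr rfl fun _ _ => by ring

theorem bernSum_mul_right (c : ℝ) : bernSum p F (fun s => f s * c) = bernSum p F f * c := by
  simp only [bernSum, sum_mul]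
  exact sum_congr rfl fun _ _ => by ring

theorem bernSum_add : bernSum p F (fun s => f s + g s) = bernSum p F f + bernSum p F g := by
  simp only [bernSum, ← sum_add_distrib]
  exact sum_congr rfl fun _ _ => by ring

theorem bernSum_sum {ι : Type*} (t : Finset ι) (f : ι → Finset E → ℝ) :
    bernSum p F (fun s => ∑ i ∈ t, f i s) = ∑ i ∈ t, bernSum p F (f i) := by
  simp only [bernSum, mul_sum]
  exact sum_comm

/-- Chebyshev's inequality for the lower tail. -/
theorem bernSum_lower_tail (hp0 : 0 ≤ p) (hp1 : p ≤ 1) {Y : Finset E → ℝ} {M x : ℝ}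
    (hM : bernSum p F Y = M) (hM0 : 0 < M) (hY : bernSum p F (fun s => Y s ^ 2) ≤ M + (1 + x) * M ^ 2) :
    bernSum p F (fun s => if Y s ≤ M / 2 then 1 else 0) ≤ 4 * (1 / M + x) := by
  have h1 : bernSum p F (fun s => if Y s ≤ M / 2 then 1 else 0) ≤
      bernSum p F (fun s => 4 / M ^ 2 * (Y s ^ 2 + (-2 * M * Y s + M ^ 2))) := by
    refine bernSum_mono hp0 hp1 fun s _ => ?_
    have h0 : (4 / M ^ 2 * (Y s ^ 2 + (-2 * M * Y s + M ^ 2))) = 4 / M ^ 2 * (M - Y s) ^ 2 := by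
      ring
    rw [h0]
    split_ifs with h
    · rw [div_mul_eq_mul_div, le_div_iff₀ (by positivity)]
      nlinarith
    · positivity
  refine h1.trans ?_
  rw [bernSum_mul_left, bernSum_add, bernSum_add, bernSum_mul_left, bernSum_const, hM]
  calc _ ≤ 4 / M ^ 2 * (M + (1 + x) * M ^ 2 + (-2 * M * M + M ^ 2)) := by gcongr
    _ = _ := by field_simp; ring

variable [DecidableEq E]

theorem bernSum_union (h : Disjoint F F') :
    bernSum p (F ∪ F') f = bernSum p F fun s => bernSum p F' fun t => f (s ∪ t) := by
  simp only [bernSum, mul_sum]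
  rw [← sum_product']
  refine sum_nbij' (fun s => (s ∩ F, s ∩ F')) (fun x => x.1 ∪ x.2) ?_ ?_ ?_ ?_ ?_
  · intro s _
    simp
  · rintro ⟨s, t⟩ hst
    simp only [mem_product, mem_powerset] at hst ⊢
    exact union_subset_union hst.1 hst.2
  · intro s hs
    rw [mem_powerset] at hs
    simp only [← inter_union_distrib_left]
    exact inter_eq_left.2 hs
  · rintro ⟨s, t⟩ hst
    simp only [mem_product, mem_powerset] at hst
    have := disjoint_left.1 h
    ext x <;> grind
  · intro s hs
    rw [mem_powerset] at hs
    have hs' : s ∩ F ∪ s ∩ F' = s := by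
      rw [← inter_union_distrib_left]; exact inter_eq_left.2 hs
    have h1 : #(s ∩ F) + #(s ∩ F') = #s := by
      rw [← card_union_of_disjoint, hs']
      exact h.mono inter_subset_right inter_subset_right
    have h2 := card_le_card (inter_subset_right : s ∩ F ⊆ F)
    have h3 := card_le_card (inter_subset_right : s ∩ F' ⊆ F')
    have h4 : #(F ∪ F') - #s = (#F - #(s ∩ F)) + (#F' - #(s ∩ F')) := by
      rw [card_union_of_disjoint h]; omega
    simp only [hs', h4, pow_add]
    rw [← h1, pow_add]
    ring

/-- Functions of disjoint parts of the random set are independent. -/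
theorem bernSum_mul_of_local (hF : F' ⊆ F) (hf : ∀ s, f s = f (s ∩ F'))
    (hg : ∀ s, g s = g (s \ F')) :
    bernSum p F (fun s => f s * g s) = bernSum p F' f * bernSum p (F \ F') g := by
  conv_lhs => rw [← union_sdiff_of_subset hF]
  rw [bernSum_union disjoint_sdiff, ← bernSum_mul_right]
  refine bernSum_congr fun s hs => ?_
  rw [← bernSum_mul_left]
  refine bernSum_congr fun t ht => ?_
  have ht' : ∀ x ∈ t, x ∉ F' := fun x hx => (Finset.mem_sdiff.1 (ht hx)).2
  have h1 : (s ∪ t) ∩ F' = s := by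
    ext x; have := @hs x; have := ht' x; grind
  have h2 : (s ∪ t) \ F' = t := by
    ext x; have := @hs x; have := ht' x; grind
  rw [hf, hg, h1, h2]

theorem bernSum_avoid (hF : F' ⊆ F) :
    bernSum p F (fun s => if Disjoint s F' then 1 else 0) = (1 - p) ^ #F' := by
  have := bernSum_mul_of_local (p := p) (f := fun s => if Disjoint s F' then 1 else 0)
    (g := fun _ => 1) hF (fun s => by
      have : Disjoint (s ∩ F') F' ↔ Disjoint s F' := by
        simp [disjoint_left]
      simp only [this]) (fun _ => rfl)
  simp only [mul_one, bernSum_const] at this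
  rw [this, bernSum, sum_eq_single ∅]
  · simp
  · intro s hs hne
    rw [if_neg, mul_zero]
    intro hd
    exact hne (disjoint_self.1 (hd.mono_right (mem_powerset.1 hs)))
  · simp

end BernSum

/-! ### Breadth-first exploration and the lower bound by tree counting. -/

section Exploration

open Finset

variable {V : Type*} [DecidableEq V]

/-- Starting from the list `L` of active vertices, the exploration that processes at most `k` of
them in turn, activating their unvisited neighbours, visits all of `U`. -/
noncomputable def Explored (s : Finset (Sym2 V)) : ℕ → List V → Finset V → Prop
  | 0, _, U => U = ∅
  | _ + 1, [], U => U = ∅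
  | k + 1, v :: L, U =>
    Explored s k (L ++ (U.filter fun u => s(v, u) ∈ s).toList) (U.filter fun u => s(v, u) ∉ s)

/-- The probability of `Explored`, as a function of the numbers of active and unvisited vertices. -/
def exploreProb (p : ℝ) : ℕ → ℕ → ℕ → ℝ
  | 0, _, m => if m = 0 then 1 else 0
  | _ + 1, 0, m => if m = 0 then 1 else 0
  | k + 1, a + 1, m => ∑ i ∈ range (m + 1),
      m.choose i • (p ^ i * (1 - p) ^ (m - i) * exploreProb p k (a + i) (m - i))

/-- Exploration never examines a pair of initially active vertices. This locality is what makes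
successive steps independent. -/
theorem explored_congr {s t : Finset (Sym2 V)} (k : ℕ) (L : List V) (U : Finset V)
    (hL : ∀ v ∈ L, v ∉ U)
    (h : ∀ x ∈ U, ∀ y, y ∈ L ∨ y ∈ U → y ≠ x → (s(y, x) ∈ s ↔ s(y, x) ∈ t)) :
    Explored s k L U ↔ Explored t k L U := by
  induction k generalizing L U with
  | zero => rfl
  | succ k ih =>
    cases L with
    | nil => rfl
    | cons v L =>
      have hv : ∀ x ∈ U, v ≠ x := fun x hx e => hL v (by simp) (e ▸ hx)
      have h1 : (U.filter fun u => s(v, u) ∈ s) = U.filter fun u => s(v, u) ∈ t :=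
        filter_congr fun x hx => h x hx v (by simp) (hv x hx)
      have h2 : (U.filter fun u => s(v, u) ∉ s) = U.filter fun u => s(v, u) ∉ t :=
        filter_congr fun x hx => not_congr (h x hx v (by simp) (hv x hx))
      simp only [Explored, h1, h2]
      refine ih _ _ (fun w hw => ?_) fun x hx y hy => h x (mem_filter.1 hx).1 y ?_
      · have := hL w
        simp only [List.mem_append, mem_toList, mem_filter, List.mem_cons, ← h1] at hw this ⊢
        grind
      · simp only [List.mem_append, mem_toList, mem_filter, List.mem_cons] at hy ⊢
        tauto

/-- Only this direction is needed: to bound the number of components from below, the sets counted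
need only be genuine components. -/
theorem Explored.reachable {s : Finset (Sym2 V)} {k : ℕ} {L : List V} {U : Finset V}
    (hL : ∀ v ∈ L, v ∉ U) (h : Explored s k L U) {u : V} (hu : u ∈ U) :
    ∃ v ∈ L, (SimpleGraph.fromEdgeSet (s : Set (Sym2 V))).Reachable v u := by
  induction k generalizing L U with
  | zero => simp only [Explored] at h; simp [h] at hu
  | succ k ih =>
    cases L with
    | nil => simp only [Explored] at h; simp [h] at hu
    | cons v L =>
      have hadj : ∀ w ∈ U, s(v, w) ∈ s →
          (SimpleGraph.fromEdgeSet (s : Set (Sym2 V))).Reachable v w := fun w hw hs =>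
        SimpleGraph.Adj.reachable <| by
          rw [SimpleGraph.fromEdgeSet_adj]
          exact ⟨hs, fun e => hL v (by simp) (e ▸ hw)⟩
      by_cases hv : s(v, u) ∈ s
      · exact ⟨v, by simp, hadj u hu hv⟩
      · simp only [Explored] at h
        obtain ⟨w, hw, hwu⟩ := ih (fun w hw => by
          have := hL w
          simp only [List.mem_append, mem_toList, mem_filter, List.mem_cons] at hw this ⊢
          tauto) h (mem_filter.2 ⟨hu, hv⟩)
        simp only [List.mem_append, mem_toList, mem_filter] at hw
        rcases hw with hw | hw
        · exact ⟨w, by simp [hw], hwu⟩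
        · exact ⟨v, by simp, (hadj w hw.1 hw.2).trans hwu⟩

-- The first step reveals exactly the star from `v` to `U`. The rest of the exploration depends only
-- on slots outside that star, so conditioning on the set `I` of discovered neighbours leaves a
-- fresh instance. Its probability depends on `I` only through its size, whence the binomial sum.
open Classical in
theorem bernSum_explored (p : ℝ) (k : ℕ) (L : List V) (U : Finset V) (F : Finset (Sym2 V))
    (hL : L.Nodup) (hLU : ∀ v ∈ L, v ∉ U)
    (hF : ∀ x ∈ U, ∀ y, y ∈ L ∨ y ∈ U → y ≠ x → s(y, x) ∈ F) :
    bernSum p F (fun s => if Explored s k L U then 1 else 0) = exploreProb p k L.length #U := by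
  induction k generalizing L U F with
  | zero =>
    by_cases h : U = ∅ <;> simp [h, Explored, exploreProb, bernSum_const]
  | succ k ih =>
    cases L with
    | nil =>
      by_cases h : U = ∅ <;> simp [h, Explored, exploreProb, bernSum_const]
    | cons v L =>
      have hv : v ∉ U := hLU v (by simp)
      have hvL : v ∉ L := (List.nodup_cons.1 hL).1
      have hinj : Function.Injective fun u => s(v, u) := fun x y h =>
        Sym2.congr_right.1 h
      have hstar : U.image (fun u => s(v, u)) ⊆ F := by
        intro e he
        obtain ⟨x, hx, rfl⟩ := mem_image.1 he
        exact hF x hx v (by simp) (fun h => hv (h ▸ hx))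
      conv_lhs => rw [← union_sdiff_of_subset hstar]
      rw [bernSum_union disjoint_sdiff]
      have key : ∀ I ⊆ U, (bernSum p (F \ U.image fun u => s(v, u)) fun t =>
          if Explored (I.image (fun u => s(v, u)) ∪ t) (k + 1) (v :: L) U then 1 else 0) =
          exploreProb p k (L.length + #I) (#U - #I) := by
        intro I hI
        have hlen : (L ++ I.toList).length = L.length + #I := by simp
        have hLI : ∀ x ∈ L ++ I.toList, x ∉ U \ I := by
          intro x hx
          have := hLU x
          have := @hI x
          simp only [List.mem_append, mem_toList, Finset.mem_sdiff] at hx this ⊢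
          grind
        rw [← hlen, ← card_sdiff_of_subset hI, ← ih (L ++ I.toList) (U \ I)
          (F \ U.image fun u => s(v, u))]
        · refine bernSum_congr fun t ht => ?_
          have ht' : ∀ u ∈ U, s(v, u) ∉ t := fun u hu h =>
            (Finset.mem_sdiff.1 (ht h)).2 (mem_image_of_mem _ hu)
          have h0 : ∀ u ∈ U, (s(v, u) ∈ I.image (fun u => s(v, u)) ∪ t ↔ u ∈ I) := by
            intro u hu
            simp only [mem_union, ht' u hu, or_false]
            exact hinj.mem_finset_image
          have h1 : (U.filter fun u => s(v, u) ∈ I.image (fun u => s(v, u)) ∪ t) = I := by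
            rw [filter_congr h0]
            ext x; have := @hI x; grind
          have h2 : (U.filter fun u => s(v, u) ∉ I.image (fun u => s(v, u)) ∪ t) = U \ I := by
            rw [filter_congr fun u hu => not_congr (h0 u hu)]
            ext x; grind
          simp only [Explored, h1, h2]
          congr 1
          rw [explored_congr _ _ _ hLI]
          intro x hx y hy _
          have hyv : y ≠ v := by
            rintro rfl
            simp only [List.mem_append, mem_toList, Finset.mem_sdiff] at hy
            grind
          have hxv : x ≠ v := by
            rintro rfl
            exact hv (Finset.mem_sdiff.1 hx).1
          simp only [mem_union, mem_image, or_iff_right_iff_imp]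
          rintro ⟨u, hu, he⟩
          rw [Sym2.eq_iff] at he
          rcases he with he | he
          · exact absurd he.1.symm hyv
          · exact absurd he.1.symm hxv
        · refine List.Nodup.append (List.nodup_cons.1 hL).2 (nodup_toList _) ?_
          intro x hx hx'
          exact hLU x (by simp [hx]) (hI (mem_toList.1 hx'))
        · exact hLI
        · intro x hx y hy hne
          rw [Finset.mem_sdiff] at hx
          simp only [List.mem_append, mem_toList, Finset.mem_sdiff] at hy
          rw [Finset.mem_sdiff]
          refine ⟨hF x hx.1 y ?_ hne, ?_⟩
          · have := @hI y
            simp only [List.mem_cons]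
            tauto
          · intro h
            obtain ⟨u, hu, he⟩ := mem_image.1 h
            rw [Sym2.eq_iff] at he
            have := @hI y
            rcases he with he | he
            · obtain ⟨rfl, rfl⟩ := he
              tauto
            · obtain ⟨rfl, rfl⟩ := he
              tauto
      have himg : (U.image fun u => s(v, u)).powerset =
          U.powerset.image (fun I => I.image fun u => s(v, u)) := by
        rw [powerset_image]
      rw [bernSum, himg, sum_image (fun I _ J _ h => image_injective hinj h)]
      simp only [card_image_of_injective _ hinj]
      rw [sum_congr rfl fun I hI => by rw [key I (mem_powerset.1 hI)],
        sum_powerset_apply_card (fun i => p ^ i * (1 - p) ^ (#U - i) *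
          exploreProb p k (L.length + i) (#U - i))]
      simp [exploreProb]

/-- The binomial theorem and its derivative, multiplied by `x + 1` to avoid the exponent `m - 1`.
With `x = a + m` this is the recursion for rooted forests by the number `i` of children of the first
root. -/
theorem sum_choose_mul_add (a m : ℕ) (x : ℝ) :
    (x + 1) * ∑ i ∈ range (m + 1), (m.choose i : ℝ) * ((a + i) * x ^ (m - i)) =
      (x + 1) ^ m * (a * (x + 1) + m) := by
  have h1 : ∑ i ∈ range (m + 1), (m.choose i : ℝ) * x ^ (m - i) = (x + 1) ^ m := by
    rw [add_comm x, add_pow]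
    exact sum_congr rfl fun i _ => by ring
  have h2 : (x + 1) * ∑ i ∈ range (m + 1), (m.choose i : ℝ) * (i * x ^ (m - i)) =
      m * (x + 1) ^ m := by
    cases m with
    | zero => simp
    | succ m =>
      rw [sum_range_succ']
      simp only [Nat.cast_zero, zero_mul, mul_zero, add_zero]
      have : ∀ i ∈ range (m + 1), ((m + 1).choose (i + 1) : ℝ) *
          (((i + 1 : ℕ) : ℝ) * x ^ (m + 1 - (i + 1))) =
          (m + 1) * (1 ^ i * x ^ (m - i) * m.choose i) := by
        intro i _
        have := Nat.add_one_mul_choose_eq m i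
        have h : ((m : ℝ) + 1) * m.choose i = (m + 1).choose (i + 1) * (i + 1) := by
          exact_mod_cast this
        rw [Nat.add_sub_add_right]
        push_cast
        linear_combination (-x ^ (m - i)) * h
      rw [sum_congr rfl this, ← mul_sum, ← add_pow]
      push_cast
      ring
  have h3 : ∑ i ∈ range (m + 1), (m.choose i : ℝ) * ((a + i) * x ^ (m - i)) =
      a * ∑ i ∈ range (m + 1), (m.choose i : ℝ) * x ^ (m - i) +
        ∑ i ∈ range (m + 1), (m.choose i : ℝ) * (i * x ^ (m - i)) := by
    rw [mul_sum, ← sum_add_distrib]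
    exact sum_congr rfl fun i _ => by ring
  rw [h3, mul_add, h2, h1]
  ring

theorem exploreProb_nonneg {p : ℝ} (hp0 : 0 ≤ p) (hp1 : p ≤ 1) (k a m : ℕ) :
    0 ≤ exploreProb p k a m := by
  have := sub_nonneg.2 hp1
  induction k generalizing a m with
  | zero => simp only [exploreProb]; positivity
  | succ k ih =>
    cases a with
    | zero => simp only [exploreProb]; positivity
    | succ a =>
      simp only [exploreProb]
      refine sum_nonneg fun i _ => ?_
      have := ih (a + i) (m - i)
      positivity

/-- A weighted form of the count `a (a + m) ^ (m - 1)` of forests with `a` given roots. -/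
theorem le_exploreProb {p : ℝ} (hp0 : 0 ≤ p) (hp1 : p ≤ 1) (k a m : ℕ) (hk : a + m ≤ k) :
    a * (a + m : ℝ) ^ m * p ^ m * (1 - p) ^ (m.choose 2 + a * m - m) ≤
      (a + m) * exploreProb p k a m := by
  have hq0 := sub_nonneg.2 hp1
  have hq1 : 1 - p ≤ 1 := by linarith
  induction k generalizing a m with
  | zero =>
    obtain ⟨rfl, rfl⟩ : a = 0 ∧ m = 0 := by omega
    simp
  | succ k ih =>
    cases a with
    | zero =>
      have := exploreProb_nonneg hp0 hp1 (k + 1) 0 m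
      simp only [Nat.cast_zero, zero_mul]
      positivity
    | succ a =>
      rcases Nat.eq_zero_or_pos (a + m) with h0 | hpos
      · obtain ⟨rfl, rfl⟩ : a = 0 ∧ m = 0 := by omega
        cases k <;> simp [exploreProb]
      have hN : (0 : ℝ) < a + m := by exact_mod_cast hpos
      -- With at least one root the subtraction does not truncate. It could for zero roots, but
      -- there the factor `a` makes the left side vanish.
      have hexp : (m.choose 2 + (a + 1) * m - m) = m.choose 2 + a * m := by
        rw [add_mul, one_mul]; omega
      have hterm : ∀ i ∈ range (m + 1),
          (m.choose i : ℝ) * ((a + i) * (a + m : ℝ) ^ (m - i)) *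
            (p ^ m * (1 - p) ^ (m.choose 2 + a * m)) ≤
          (a + m) * (m.choose i • (p ^ i * (1 - p) ^ (m - i) * exploreProb p k (a + i) (m - i))) := by
        intro i hi
        have him : i ≤ m := by simpa [Nat.lt_succ_iff] using hi
        obtain ⟨j, rfl⟩ := Nat.exists_eq_add_of_le him
        have := ih (a + i) j (by omega)
        rcases Nat.eq_zero_or_pos (a + i) with hai | hai
        · have h0 : (a : ℝ) + i = 0 := by exact_mod_cast hai
          have := exploreProb_nonneg hp0 hp1 k (a + i) (i + j - i)
          rw [h0, zero_mul, mul_zero, zero_mul, nsmul_eq_mul]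
          positivity
        rw [Nat.add_sub_cancel_left, nsmul_eq_mul]
        have hch : (i + j).choose 2 = i.choose 2 + i * j + j.choose 2 := by
          have h : ((i + j).choose 2 : ℚ) = i.choose 2 + i * j + j.choose 2 := by
            simp only [Nat.cast_choose_two]; push_cast; ring
          exact_mod_cast h
        -- The slack consists of the pairs joining the `i` new vertices to each other and to the `a`
        -- older active ones, which exploration never examines.
        have hle : j + (j.choose 2 + (a + i) * j - j) ≤ (i + j).choose 2 + a * (i + j) := by
          rw [hch, add_mul, mul_add]
          rcases Nat.eq_zero_or_pos a with rfl | ha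
          · have : j ≤ i * j := Nat.le_mul_of_pos_left _ (by omega)
            omega
          · have : j ≤ a * j := Nat.le_mul_of_pos_left _ ha
            omega
        have hpow : (1 - p) ^ ((i + j).choose 2 + a * (i + j)) ≤
            (1 - p) ^ j * (1 - p) ^ (j.choose 2 + (a + i) * j - j) := by
          rw [← pow_add]
          exact pow_le_pow_of_le_one hq0 hq1 hle
        have hc : ((a + i : ℕ) : ℝ) + j = a + (i + j : ℕ) := by push_cast; ring
        rw [hc] at this
        calc _ ≤ ((i + j).choose i : ℝ) * ((a + i) * (a + (i + j : ℕ) : ℝ) ^ j) *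
            (p ^ (i + j) * ((1 - p) ^ j * (1 - p) ^ (j.choose 2 + (a + i) * j - j))) := by
              gcongr
          _ = ((i + j).choose i : ℝ) * p ^ i * (1 - p) ^ j * (((a + i : ℕ) : ℝ) *
              (a + (i + j : ℕ) : ℝ) ^ j * p ^ j * (1 - p) ^ (j.choose 2 + (a + i) * j - j)) := by
              push_cast; ring
          _ ≤ ((i + j).choose i : ℝ) * p ^ i * (1 - p) ^ j *
              ((a + (i + j : ℕ) : ℝ) * exploreProb p k (a + i) j) := by gcongr
          _ = _ := by ring
      have hsum := sum_le_sum hterm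
      rw [← sum_mul, ← mul_sum] at hsum
      have hid := sum_choose_mul_add a m ((a : ℝ) + m)
      simp only [exploreProb]
      refine le_of_mul_le_mul_left ?_ hN
      rw [hexp]
      push_cast
      calc _ = ((a : ℝ) + m + 1) ^ m * (a * (a + m + 1) + m) *
              (p ^ m * (1 - p) ^ (m.choose 2 + a * m)) := by ring
        _ = ((a : ℝ) + m + 1) * ((∑ i ∈ range (m + 1), (m.choose i : ℝ) *
              ((a + i) * (a + m : ℝ) ^ (m - i))) *
              (p ^ m * (1 - p) ^ (m.choose 2 + a * m))) := by rw [← hid]; ring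
        _ ≤ _ := mul_le_mul_of_nonneg_left hsum (by positivity)
        _ = _ := by ring

end Exploration

/-! ### Vertex sets that are components: their probabilities and the first two moments of their
number. -/

section Components

open Finset

variable {V : Type*} [Fintype V] [DecidableEq V]

/-- The vertex set `A`, explored from its vertex `r A`, is a connected component of the graph with
edge set `s`. -/
def IsComponentFrom (r : Finset V → V) (s : Finset (Sym2 V)) (A : Finset V) : Prop :=
  Explored s #A [r A] (A.erase (r A)) ∧ ∀ x ∈ A, ∀ y ∉ A, s(x, y) ∉ s

/-- The pairs of distinct vertices. -/
def edgeSlots (V : Type*) [Fintype V] [DecidableEq V] : Finset (Sym2 V) :=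
  univ.filter fun e => ¬ e.IsDiag

/-- The pairs of distinct vertices of `A`. -/
def innerSlots (A : Finset V) : Finset (Sym2 V) :=
  A.sym2.filter fun e => ¬ e.IsDiag

/-- The unordered pairs underlying a set of ordered pairs. -/
def unordered (P : Finset (V × V)) : Finset (Sym2 V) :=
  P.image fun x => s(x.1, x.2)

omit [Fintype V] in
theorem mem_unordered {P : Finset (V × V)} {x y : V} :
    s(x, y) ∈ unordered P ↔ (x, y) ∈ P ∨ (y, x) ∈ P := by
  simp only [unordered, mem_image, Prod.exists, Sym2.eq_iff]
  constructor
  · rintro ⟨a, b, h, ⟨rfl, rfl⟩ | ⟨rfl, rfl⟩⟩ <;> simp [h]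
  · rintro (h | h)
    · exact ⟨x, y, h, by simp⟩
    · exact ⟨y, x, h, by simp⟩

omit [Fintype V] in
theorem card_unordered {P : Finset (V × V)} (h : ∀ x y, (x, y) ∈ P → (y, x) ∉ P) :
    #(unordered P) = #P := by
  refine card_image_of_injOn ?_
  rintro ⟨a, b⟩ hab ⟨c, d⟩ hcd he
  rcases Sym2.eq_iff.1 he with ⟨rfl, rfl⟩ | ⟨rfl, rfl⟩
  · rfl
  · exact absurd hcd (h _ _ hab)

omit [Fintype V] in
theorem mem_innerSlots {A : Finset V} {x y : V} :
    s(x, y) ∈ innerSlots A ↔ x ∈ A ∧ y ∈ A ∧ x ≠ y := by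
  simp [innerSlots, and_assoc]

theorem mem_edgeSlots {x y : V} : s(x, y) ∈ edgeSlots V ↔ x ≠ y := by
  simp [edgeSlots]

theorem disjoint_unordered_iff {s : Finset (Sym2 V)} {A : Finset V} :
    Disjoint s (unordered (A ×ˢ Aᶜ)) ↔ ∀ x ∈ A, ∀ y ∉ A, s(x, y) ∉ s := by
  rw [disjoint_right]
  constructor
  · intro h x hx y hy
    exact h (mem_unordered.2 (by simp [hx, hy]))
  · intro h e
    induction e with | h x y => ?_
    rw [mem_unordered]
    simp only [mem_product, mem_compl]
    rintro (⟨hx, hy⟩ | ⟨hy, hx⟩)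
    · exact h x hx y hy
    · rw [Sym2.eq_swap]
      exact h y hy x hx

variable {r : Finset V → V} {A B : Finset V}

omit [Fintype V] in
theorem explored_inter_innerSlots (hA : r A ∈ A) {s t : Finset (Sym2 V)}
    (h : ∀ e ∈ innerSlots A, e ∈ s ↔ e ∈ t) (k : ℕ) :
    Explored s k [r A] (A.erase (r A)) ↔ Explored t k [r A] (A.erase (r A)) := by
  refine explored_congr _ _ _ (by simp) fun x hx y hy hne => h _ (mem_innerSlots.2 ?_)
  simp only [List.mem_singleton, mem_erase] at hx hy
  refine ⟨?_, hx.2, hne⟩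
  rcases hy with rfl | hy
  exacts [hA, hy.2]

/-- The probability that a given set of `a` vertices is connected. -/
def connectProb (p : ℝ) (a : ℕ) : ℝ := exploreProb p a 1 (a - 1)

omit [Fintype V] in
open Classical in
theorem bernSum_explored_root (p : ℝ) (hA : r A ∈ A) :
    bernSum p (innerSlots A) (fun s => if Explored s #A [r A] (A.erase (r A)) then 1 else 0) =
      connectProb p #A := by
  rw [bernSum_explored _ _ _ _ _ (by simp) (by simp), connectProb, card_erase_of_mem hA]
  · rfl
  · intro x hx y hy hne
    simp only [List.mem_singleton, mem_erase] at hx hy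
    refine mem_innerSlots.2 ⟨?_, hx.2, hne⟩
    rcases hy with rfl | hy
    exacts [hA, hy.2]

-- Internal connectivity and absence of boundary edges concern disjoint sets of slots, hence are
-- independent.
open Classical in
theorem bernSum_isComponentFrom (p : ℝ) (hA : r A ∈ A) :
    bernSum p (edgeSlots V) (fun s => if IsComponentFrom r s A then 1 else 0) =
      connectProb p #A * (1 - p) ^ (#A * (Fintype.card V - #A)) := by
  have h1 : ∀ s : Finset (Sym2 V), (if IsComponentFrom r s A then (1 : ℝ) else 0) =
      (if Explored s #A [r A] (A.erase (r A)) then 1 else 0) *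
        (if Disjoint s (unordered (A ×ˢ Aᶜ)) then 1 else 0) := by
    intro s
    simp only [IsComponentFrom, ← disjoint_unordered_iff, ite_and]
    split_ifs <;> simp
  have hdisj : ∀ e ∈ unordered (A ×ˢ Aᶜ), e ∉ innerSlots A := by
    intro e
    induction e with | h x y => ?_
    rw [mem_unordered, mem_innerSlots]
    simp only [mem_product, mem_compl]
    tauto
  have hdiag : ∀ e ∈ unordered (A ×ˢ Aᶜ), e ∈ edgeSlots V := by
    intro e
    induction e with | h x y => ?_
    rw [mem_unordered, mem_edgeSlots]
    simp only [mem_product, mem_compl]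
    rintro h rfl
    tauto
  simp only [h1]
  rw [bernSum_mul_of_local (F' := innerSlots A), bernSum_explored_root p hA, bernSum_avoid,
    card_unordered, card_product, card_compl]
  · intro x y
    simp only [mem_product, mem_compl]
    tauto
  · intro e he
    exact Finset.mem_sdiff.2 ⟨hdiag e he, hdisj e he⟩
  · intro e
    induction e with | h x y => ?_
    rw [mem_innerSlots, mem_edgeSlots]
    tauto
  · intro s
    simp only [explored_inter_innerSlots (s := s ∩ innerSlots A) (t := s) hA (by grind)]
  · intro s
    have : Disjoint (s \ innerSlots A) (unordered (A ×ˢ Aᶜ)) ↔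
        Disjoint s (unordered (A ×ˢ Aᶜ)) := by
      simp only [disjoint_right, Finset.mem_sdiff]
      grind
    simp only [this]

-- The slots between `A` and `B` must be empty for both events but are paid for only once: the
-- boundary is split into `A ×ˢ Aᶜ` and `B ×ˢ (A ∪ B)ᶜ`, so that no unordered pair is repeated.
open Classical in
theorem bernSum_isComponentFrom_pair (p : ℝ) (hA : r A ∈ A) (hB : r B ∈ B) (hAB : Disjoint A B) :
    bernSum p (edgeSlots V) (fun s => (if IsComponentFrom r s A then 1 else 0) *
      (if IsComponentFrom r s B then 1 else 0)) =
      connectProb p #A * connectProb p #B *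
        (1 - p) ^ (#A * (Fintype.card V - #A) + #B * (Fintype.card V - #A - #B)) := by
  have hAB' := disjoint_left.1 hAB
  set P : Finset (V × V) := A ×ˢ Aᶜ ∪ B ×ˢ (A ∪ B)ᶜ with hP
  have h1 : ∀ s : Finset (Sym2 V), ((if IsComponentFrom r s A then (1 : ℝ) else 0) *
      (if IsComponentFrom r s B then 1 else 0)) =
      (if Explored s #A [r A] (A.erase (r A)) then 1 else 0) *
      ((if Explored s #B [r B] (B.erase (r B)) then 1 else 0) *
        (if Disjoint s (unordered P) then 1 else 0)) := by
    intro s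
    have h : Disjoint s (unordered P) ↔ Disjoint s (unordered (A ×ˢ Aᶜ)) ∧
        Disjoint s (unordered (B ×ˢ Bᶜ)) := by
      simp only [disjoint_right, ← forall_and]
      refine forall_congr' fun e => ?_
      induction e with | h x y => ?_
      have := @hAB' x
      have := @hAB' y
      simp only [mem_unordered, hP, mem_union, mem_product, mem_compl]
      tauto
    simp only [ite_zero_mul_ite_zero, mul_one]
    simp only [IsComponentFrom, ← disjoint_unordered_iff, h]
    congr 1
    simp only [eq_iff_iff]
    tauto
  have hmem : ∀ e ∈ unordered P, e ∈ edgeSlots V ∧ e ∉ innerSlots A ∧ e ∉ innerSlots B := by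
    intro e
    induction e with | h x y => ?_
    have := @hAB' x
    have := @hAB' y
    rw [mem_unordered, mem_innerSlots, mem_innerSlots, mem_edgeSlots]
    simp only [hP, mem_union, mem_product, mem_compl]
    grind
  have hinner : ∀ e ∈ innerSlots B, e ∈ edgeSlots V ∧ e ∉ innerSlots A := by
    intro e
    induction e with | h x y => ?_
    have := @hAB' x
    rw [mem_innerSlots, mem_innerSlots, mem_edgeSlots]
    grind
  have hPcard : #P = #A * (Fintype.card V - #A) + #B * (Fintype.card V - #A - #B) := by
    rw [hP, card_union_of_disjoint, card_product, card_product, card_compl, card_compl,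
      card_union_of_disjoint hAB, Nat.sub_sub]
    rw [disjoint_left]
    rintro ⟨x, y⟩
    have := @hAB' x
    simp only [mem_product]
    tauto
  simp only [h1]
  rw [bernSum_mul_of_local (F' := innerSlots A), bernSum_explored_root p hA,
    bernSum_mul_of_local (F' := innerSlots B), bernSum_explored_root p hB, bernSum_avoid,
    card_unordered, hPcard, mul_assoc]
  · intro x y
    have := @hAB' x
    have := @hAB' y
    simp only [hP, mem_union, mem_product, mem_compl]
    tauto
  · intro e he
    have := hmem e he
    simp only [Finset.mem_sdiff]
    tauto
  · intro e he
    exact Finset.mem_sdiff.2 (hinner e he)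
  · intro s
    simp only [explored_inter_innerSlots (s := s ∩ innerSlots B) (t := s) hB (by grind)]
  · intro s
    have : Disjoint (s \ innerSlots B) (unordered P) ↔ Disjoint s (unordered P) := by
      simp only [disjoint_right, Finset.mem_sdiff]
      grind
    simp only [this]
  · intro e
    induction e with | h x y => ?_
    rw [mem_innerSlots, mem_edgeSlots]
    tauto
  · intro s
    simp only [explored_inter_innerSlots (s := s ∩ innerSlots A) (t := s) hA (by grind)]
  · intro s
    have : Disjoint (s \ innerSlots A) (unordered P) ↔ Disjoint s (unordered P) := by
      simp only [disjoint_right, Finset.mem_sdiff]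
      grind
    simp only [this, explored_inter_innerSlots (s := s \ innerSlots A) (t := s) hB (by grind)]

omit [Fintype V] in
theorem IsComponentFrom.supp_eq {s : Finset (Sym2 V)} (hA : r A ∈ A) (h : IsComponentFrom r s A) :
    ((SimpleGraph.fromEdgeSet (s : Set (Sym2 V))).connectedComponentMk (r A)).supp = A := by
  ext x
  rw [SimpleGraph.ConnectedComponent.mem_supp_iff, SimpleGraph.ConnectedComponent.eq, mem_coe]
  constructor
  · intro hx
    by_contra hxA
    obtain ⟨w⟩ := hx.symm
    obtain ⟨d, -, hd1, hd2⟩ := w.exists_boundary_dart (A : Set V) hA hxA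
    have := d.adj
    rw [SimpleGraph.fromEdgeSet_adj] at this
    exact h.2 _ hd1 _ hd2 this.1
  · intro hx
    by_cases hxr : x = r A
    · rw [hxr]
    · obtain ⟨v, hv, hvx⟩ := h.1.reachable (by simp) (mem_erase.2 ⟨hxr, hx⟩)
      simp only [List.mem_singleton] at hv
      exact hv ▸ hvx.symm

omit [Fintype V] in
theorem IsComponentFrom.eq_or_disjoint {s : Finset (Sym2 V)} (hA : r A ∈ A) (hB : r B ∈ B)
    (h : IsComponentFrom r s A) (h' : IsComponentFrom r s B) : A = B ∨ Disjoint A B := by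
  by_cases hd : Disjoint A B
  · exact Or.inr hd
  · left
    obtain ⟨x, hx, hx'⟩ := not_disjoint_iff.1 hd
    rw [← mem_coe, ← h.supp_eq hA] at hx
    rw [← mem_coe, ← h'.supp_eq hB] at hx'
    rw [SimpleGraph.ConnectedComponent.mem_supp_iff] at hx hx'
    rw [← coe_inj, ← h.supp_eq hA, ← h'.supp_eq hB, ← hx, hx']

open Classical in
/-- The number of vertex sets with size in `W` that are components. -/
noncomputable def componentCount (r : Finset V → V) (W : Finset ℕ) (s : Finset (Sym2 V)) : ℝ :=
  ∑ A ∈ univ.filter (fun A => #A ∈ W), if IsComponentFrom r s A then 1 else 0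

/-- A counted set is the support of the component of its root, so sending the set to that component
is injective. -/
theorem componentCount_le (hr : ∀ A : Finset V, A.Nonempty → r A ∈ A) {W : Finset ℕ} {b : ℝ}
    (hb : 0 < b) (hW : ∀ k ∈ W, b ≤ k ∧ (k : ℝ) ≤ 2 * b) (s : Finset (Sym2 V)) :
    componentCount r W s ≤
      (componentsInWindow (SimpleGraph.fromEdgeSet (s : Set (Sym2 V))) b).ncard := by
  classical
  rw [componentCount, ← sum_filter, sum_const, nsmul_one, ← Set.ncard_coe_finset]
  have hpos : ∀ A : Finset V, #A ∈ W → r A ∈ A := fun A hA =>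
    hr A (card_pos.1 (by exact_mod_cast hb.trans_le (hW _ hA).1))
  refine Nat.cast_le.2 (Set.ncard_le_ncard_of_injOn
    (fun A => (SimpleGraph.fromEdgeSet (s : Set (Sym2 V))).connectedComponentMk (r A)) ?_ ?_
    (Set.toFinite _))
  · intro A hA
    simp only [coe_filter, mem_filter, mem_univ, true_and, Set.mem_ofPred_eq] at hA
    simp only [componentsInWindow, componentSize, Set.mem_ofPred_eq,
      hA.2.supp_eq (hpos A hA.1), Set.ncard_coe_finset]
    exact hW _ hA.1
  · intro A hA B hB he
    simp only [coe_filter, mem_filter, mem_univ, true_and, Set.mem_ofPred_eq] at hA hB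
    rw [← coe_inj, ← hA.2.supp_eq (hpos A hA.1), ← hB.2.supp_eq (hpos B hB.1)]
    exact congrArg _ he

theorem bernSum_componentCount (hr : ∀ A : Finset V, A.Nonempty → r A ∈ A) {W : Finset ℕ}
    (hW : 0 ∉ W) (p : ℝ) :
    bernSum p (edgeSlots V) (componentCount r W) = ∑ A : Finset V with #A ∈ W,
      connectProb p #A * (1 - p) ^ (#A * (Fintype.card V - #A)) := by
  unfold componentCount
  rw [bernSum_sum]
  refine sum_congr rfl fun A hA => bernSum_isComponentFrom p (hr A (card_pos.1 ?_))
  exact Nat.pos_of_ne_zero fun h => hW (h ▸ (mem_filter.1 hA).2)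

omit [DecidableEq V] in
theorem sum_card_mem (n : ℕ) (hn : Fintype.card V = n) (W : Finset ℕ) (hW : ∀ k ∈ W, k ≤ n)
    (f : ℕ → ℝ) : ∑ A : Finset V with #A ∈ W, f #A = ∑ k ∈ W, n.choose k * f k := by
  rw [sum_filter, ← powerset_univ,
    sum_powerset_apply_card (fun k => if k ∈ W then f k else 0), card_univ, hn]
  simp only [smul_ite, smul_zero, nsmul_eq_mul]
  rw [← sum_filter]
  refine sum_congr ?_ fun _ _ => rfl
  ext k
  have := hW k
  simp only [mem_filter, mem_range]
  grind

theorem sum_card_mem_disjoint (A : Finset V) (W : Finset ℕ)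
    (f : ℕ → ℝ) (hf : ∀ k, 0 ≤ f k) : ∑ B : Finset V with #B ∈ W ∧ Disjoint A B, f #B ≤
      ∑ k ∈ W, (Fintype.card V - #A).choose k * f k := by
  have h1 : (univ.filter fun B : Finset V => #B ∈ W ∧ Disjoint A B) =
      (Aᶜ).powerset.filter fun B => #B ∈ W := by
    ext B
    simp only [mem_filter, mem_univ, true_and, mem_powerset, subset_compl_comm]
    rw [subset_compl_iff_disjoint_right, and_comm]
  rw [h1, sum_filter, sum_powerset_apply_card (fun k => if k ∈ W then f k else 0), card_compl]
  simp only [smul_ite, smul_zero, nsmul_eq_mul]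
  rw [← sum_filter]
  refine sum_le_sum_of_subset_of_nonneg (fun k hk => (mem_filter.1 hk).2) fun k _ _ => ?_
  have := hf k
  positivity

/-- In the expansion of the square, the diagonal gives the mean, and intersecting distinct sets
contribute nothing. For disjoint pairs, `hx` compares the count of `k`-sets outside a `j`-component
with the unconditional one. -/
theorem bernSum_componentCount_sq_le (hr : ∀ A : Finset V, A.Nonempty → r A ∈ A) {W : Finset ℕ}
    (hW : 0 ∉ W) {p x : ℝ} (hp0 : 0 ≤ p) (hp1 : p ≤ 1) (n : ℕ) (hn : Fintype.card V = n)
    (hWn : ∀ k ∈ W, k ≤ n)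
    (hx : ∀ j ∈ W, ∀ k ∈ W, ((n - j).choose k : ℝ) * (1 - p) ^ (k * (n - j - k)) ≤
      (1 + x) * (n.choose k * (1 - p) ^ (k * (n - k)))) :
    bernSum p (edgeSlots V) (fun s => componentCount r W s ^ 2) ≤
      bernSum p (edgeSlots V) (componentCount r W) +
        (1 + x) * bernSum p (edgeSlots V) (componentCount r W) ^ 2 := by
  classical
  have hq0 := sub_nonneg.2 hp1
  have hpos : ∀ A : Finset V, #A ∈ W → r A ∈ A := fun A hA =>
    hr A (card_pos.1 (Nat.pos_of_ne_zero fun h => hW (h ▸ hA)))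
  have hc : ∀ k, 0 ≤ connectProb p k := fun k => exploreProb_nonneg hp0 hp1 _ _ _
  have hM : bernSum p (edgeSlots V) (componentCount r W) =
      ∑ k ∈ W, n.choose k * (connectProb p k * (1 - p) ^ (k * (n - k))) := by
    rw [bernSum_componentCount hr hW, hn]
    exact sum_card_mem n hn W hWn fun k => connectProb p k * (1 - p) ^ (k * (n - k))
  have hA : ∀ A : Finset V, #A ∈ W →
      bernSum p (edgeSlots V) (fun s => (if IsComponentFrom r s A then 1 else 0) *
        componentCount r W s) ≤ connectProb p #A * (1 - p) ^ (#A * (n - #A)) *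
          (1 + (1 + x) * bernSum p (edgeSlots V) (componentCount r W)) := by
    intro A hAW
    have h1 : bernSum p (edgeSlots V) (fun s => (if IsComponentFrom r s A then 1 else 0) *
        componentCount r W s) ≤ bernSum p (edgeSlots V) (fun s =>
          (if IsComponentFrom r s A then 1 else 0) +
          ∑ B : Finset V with #B ∈ W ∧ Disjoint A B, (if IsComponentFrom r s A then 1 else 0) *
            (if IsComponentFrom r s B then 1 else 0)) := by
      refine bernSum_mono hp0 hp1 fun s _ => ?_
      by_cases hs : IsComponentFrom r s A
      · simp only [hs, if_true, one_mul]
        rw [componentCount, ← sum_erase_add _ _ (show A ∈ univ.filter (fun A => #A ∈ W) by simpa),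
          if_pos hs, add_comm]
        refine add_le_add le_rfl ?_
        rw [← sum_filter, ← sum_filter (p := fun B => IsComponentFrom r s B), sum_const, sum_const,
          nsmul_one, nsmul_one]
        refine Nat.cast_le.2 (card_le_card fun B hB => ?_)
        simp only [mem_filter, mem_erase, mem_univ, true_and] at hB ⊢
        refine ⟨⟨hB.1.2, ?_⟩, hB.2⟩
        exact (hs.eq_or_disjoint (hpos A hAW) (hpos B hB.1.2) hB.2).resolve_left
          (Ne.symm hB.1.1)
      · simp [hs]
    refine h1.trans ?_
    rw [bernSum_add, bernSum_isComponentFrom p (hpos A hAW), bernSum_sum, hn]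
    rw [sum_congr rfl fun B hB => bernSum_isComponentFrom_pair p (hpos A hAW)
      (hpos B (mem_filter.1 hB).2.1) (mem_filter.1 hB).2.2, hn]
    have h2 : ∑ B : Finset V with #B ∈ W ∧ Disjoint A B, connectProb p #A * connectProb p #B *
        (1 - p) ^ (#A * (n - #A) + #B * (n - #A - #B)) =
        connectProb p #A * (1 - p) ^ (#A * (n - #A)) *
          ∑ B : Finset V with #B ∈ W ∧ Disjoint A B,
            connectProb p #B * (1 - p) ^ (#B * (n - #A - #B)) := by
      rw [mul_sum]
      exact sum_congr rfl fun B _ => by rw [pow_add]; ring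
    rw [h2, mul_add, mul_one]
    have := hc #A
    gcongr
    refine (sum_card_mem_disjoint A W
      (fun k => connectProb p k * (1 - p) ^ (k * (n - #A - k))) fun k => ?_).trans ?_
    · have := hc k
      positivity
    · rw [hn, hM, mul_sum]
      refine sum_le_sum fun k hk => ?_
      have := mul_le_mul_of_nonneg_left (hx #A hAW k hk) (hc k)
      linarith
  have h3 : ∀ s, componentCount r W s ^ 2 = ∑ A : Finset V with #A ∈ W,
      (if IsComponentFrom r s A then 1 else 0) * componentCount r W s := by
    intro s
    rw [← sum_mul, sq]
    rfl
  simp only [h3]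
  rw [bernSum_sum]
  refine (sum_le_sum fun A hAW => hA A (mem_filter.1 hAW).2).trans ?_
  rw [← sum_mul, ← hn, ← bernSum_componentCount hr hW]
  exact le_of_eq (by ring)

/-- Graphs correspond to subsets of `edgeSlots V`, which turns the measure into a finite weighted
sum. -/
theorem binomialRandom_real_eq (p : unitInterval) (P : SimpleGraph V → Prop) [DecidablePred P] :
    (SimpleGraph.binomialRandom V p).real {G | P G} = bernSum p (edgeSlots V)
      (fun s => if P (SimpleGraph.fromEdgeSet (s : Set (Sym2 V))) then 1 else 0) := by
  classical
  have hms : ∀ G : SimpleGraph V, MeasurableSet {G} := by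
    intro G
    have : ({G} : Set (SimpleGraph V)) = SimpleGraph.edgeSet ⁻¹' {G.edgeSet} := by
      ext H
      simp
    rw [this]
    exact SimpleGraph.measurable_edgeSet (measurableSet_singleton _)
  have : MeasurableSingletonClass (SimpleGraph V) := ⟨hms⟩
  have hset : {G : SimpleGraph V | P G} = ((univ.filter P : Finset (SimpleGraph V)) : Set _) := by
    simp
  rw [hset, ← sum_measureReal_singleton, sum_filter, bernSum]
  have hcard : #(edgeSlots V) = (Fintype.card V).choose 2 := by
    rw [edgeSlots, ← Fintype.card_subtype, Sym2.card_subtype_not_diag]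
  refine sum_bij (fun G _ => G.edgeFinset) ?_ ?_ ?_ ?_
  · intro G _
    refine mem_powerset.2 fun e he => ?_
    rw [SimpleGraph.mem_edgeFinset] at he
    simpa [edgeSlots] using G.not_isDiag_of_mem_edgeSet he
  · intro G _ H _ h
    exact SimpleGraph.edgeFinset_inj.1 h
  · intro s hs
    refine ⟨SimpleGraph.fromEdgeSet (s : Set (Sym2 V)), mem_univ _, ?_⟩
    rw [← coe_inj, SimpleGraph.coe_edgeFinset, SimpleGraph.edgeSet_fromEdgeSet]
    ext e
    have : e ∈ s → e ∈ edgeSlots V := fun h => mem_powerset.1 hs h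
    simp only [edgeSlots, mem_filter, mem_univ, true_and] at this
    simpa using this
  · intro G _
    rw [SimpleGraph.coe_edgeFinset, SimpleGraph.fromEdgeSet_edgeSet]
    split_ifs
    · rw [mul_one, measureReal_def, SimpleGraph.binomialRandom_singleton, hcard,
        ← SimpleGraph.coe_edgeFinset, Set.ncard_coe_finset, Nat.card_eq_fintype_card]
      simp
    · simp

end Components

/-! ### Analytic estimates for the moments. -/

section Estimates

open Real

/-- Negative `x` is allowed, so the bound serves both `1 - p` and `1 + ε`, whatever the sign of `ε`.
-/
theorem exp_neg_sub_two_sq_le {x : ℝ} (hx : x ≤ 1 / 2) : exp (-x - 2 * x ^ 2) ≤ 1 - x := by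
  have h0 : 0 < 1 - x := by linarith
  rw [← le_log_iff_exp_le h0]
  refine le_trans ?_ (one_sub_inv_le_log_of_pos h0)
  have h : 1 - (1 - x)⁻¹ = -x - x ^ 2 / (1 - x) := by field_simp; ring
  rw [h]
  have : x ^ 2 / (1 - x) ≤ 2 * x ^ 2 := by
    rw [div_le_iff₀ h0]
    nlinarith [sq_nonneg x]
  linarith

theorem exp_le_one_add_two_mul {y : ℝ} (h0 : 0 ≤ y) (h1 : y ≤ 1 / 2) : exp y ≤ 1 + 2 * y := by
  have h := one_sub_le_exp_neg y
  have h2 : exp (-y) * exp y = 1 := by rw [← exp_add]; simp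
  have h3 := exp_pos y
  nlinarith

/-- Stirling's sequence decreases from its first value e/√2. -/
theorem factorial_le_exp_mul {k : ℕ} (hk : 1 ≤ k) :
    (k.factorial : ℝ) ≤ exp 1 * √k * (k / exp 1) ^ k := by
  obtain ⟨k, rfl⟩ := Nat.exists_eq_add_of_le' hk
  have h := Stirling.stirlingSeq'_antitone (Nat.zero_le k)
  simp only [Function.comp_apply, Nat.succ_eq_add_one, zero_add, Stirling.stirlingSeq_one] at h
  rw [Stirling.stirlingSeq, div_le_div_iff₀ (by positivity) (by positivity),
    sqrt_mul (by norm_num)] at h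
  have h2 : (0 : ℝ) < √2 := by positivity
  refine le_of_mul_le_mul_right ?_ h2
  calc _ ≤ _ := h
    _ = _ := by ring

theorem choose_sub_mul_le {n j k : ℕ} (h : j + k ≤ n) (hn : 0 < n) :
    ((n - j).choose k : ℝ) ≤ n.choose k * exp (-(j * k / n)) := by
  have hn' : (0 : ℝ) < n := by exact_mod_cast hn
  have h1 : ((n - j).descFactorial k : ℝ) ≤ n.descFactorial k * (1 - j / n) ^ k := by
    induction k with
    | zero => simp
    | succ k ih =>
      rw [Nat.descFactorial_succ, Nat.descFactorial_succ, Nat.cast_mul, Nat.cast_mul, pow_succ]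
      have h2 : ((n - j - k : ℕ) : ℝ) ≤ (n - k : ℕ) * (1 - j / n) := by
        rw [Nat.sub_sub, Nat.cast_sub (by omega), Nat.cast_sub (by omega)]
        push_cast
        have : ((n : ℝ) - k) * (1 - j / n) = n - (j + k) + k * j / n := by field_simp; ring
        rw [this]
        have : (0 : ℝ) ≤ k * j / n := by positivity
        linarith
      have h3 : (0 : ℝ) ≤ 1 - j / n := by
        rw [sub_nonneg, div_le_one hn']
        exact_mod_cast (by omega : j ≤ n)
      calc _ ≤ ((n - k : ℕ) * (1 - j / n : ℝ)) * (n.descFactorial k * (1 - j / n) ^ k) :=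
            mul_le_mul h2 (ih (by omega)) (by positivity) (by positivity)
        _ = _ := by ring
  have h2 : (1 - j / n : ℝ) ^ k ≤ exp (-(j * k / n)) := by
    have h3 : (0 : ℝ) ≤ 1 - j / n := by
      rw [sub_nonneg, div_le_one hn']
      exact_mod_cast (by omega : j ≤ n)
    calc _ ≤ exp (-(j / n)) ^ k := pow_le_pow_left₀ h3 (one_sub_le_exp_neg _) k
      _ = _ := by rw [← exp_nat_mul]; congr 1; ring
  have hk : (0 : ℝ) < k.factorial := by exact_mod_cast k.factorial_pos
  rw [Nat.descFactorial_eq_factorial_mul_choose, Nat.descFactorial_eq_factorial_mul_choose] at h1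
  push_cast at h1
  rw [mul_assoc] at h1
  refine (le_of_mul_le_mul_left h1 hk).trans ?_
  gcongr

/-- Removing `j` vertices costs a factor exp(-jk/n) in the choice of a `k`-set but saves `j * k`
boundary slots, worth at most exp(jk(p + 2p²)). -/
theorem choose_sub_mul_pow_le {n j k : ℕ} (h : j + k ≤ n) (hn : 0 < n) {p : ℝ} (hp : p ≤ 1 / 2) :
    ((n - j).choose k : ℝ) * (1 - p) ^ (k * (n - j - k)) ≤
      exp (j * k * (p + 2 * p ^ 2 - 1 / n)) * (n.choose k * (1 - p) ^ (k * (n - k))) := by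
  have hq : 0 ≤ 1 - p := by linarith
  have h1 : k * (n - k) = k * (n - j - k) + k * j := by
    rw [← mul_add]; congr 1; omega
  have h2 : exp (-(j * k * (p + 2 * p ^ 2))) ≤ (1 - p) ^ (k * j) := by
    calc _ = exp (-p - 2 * p ^ 2) ^ (k * j) := by
          rw [← exp_nat_mul]; congr 1; push_cast; ring
      _ ≤ _ := pow_le_pow_left₀ (exp_pos _).le (exp_neg_sub_two_sq_le hp) _
  rw [h1, pow_add]
  calc _ ≤ n.choose k * exp (-(j * k / n)) * (1 - p) ^ (k * (n - j - k)) := by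
        gcongr
        exact choose_sub_mul_le h hn
    _ = exp (j * k * (p + 2 * p ^ 2 - 1 / n)) * (n.choose k * ((1 - p) ^ (k * (n - j - k)) *
        exp (-(j * k * (p + 2 * p ^ 2))))) := by
        have : exp (-(j * k / n : ℝ)) = exp (j * k * (p + 2 * p ^ 2 - 1 / n)) *
            exp (-(j * k * (p + 2 * p ^ 2))) := by
          rw [← exp_add]; congr 1; ring
        rw [this]; ring
    _ ≤ _ := by gcongr

theorem pow_mul_exp_le_descFactorial {n k : ℕ} (hn : 0 < n) (h : 2 * k ≤ n) :
    (n : ℝ) ^ k * exp (-(k ^ 2 / (2 * n) + 2 * k ^ 3 / n ^ 2)) ≤ n.descFactorial k := by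
  have hn' : (0 : ℝ) < n := by exact_mod_cast hn
  induction k with
  | zero => simp
  | succ k ih =>
    have hk : (k : ℝ) / n ≤ 1 / 2 := by
      rw [div_le_div_iff₀ hn' two_pos]
      exact_mod_cast (by omega : k * 2 ≤ 1 * n)
    have h1 : (n : ℝ) * exp (-(k / n) - 2 * (k / n) ^ 2) ≤ (n - k : ℕ) := by
      rw [Nat.cast_sub (by omega)]
      calc _ ≤ (n : ℝ) * (1 - k / n) := by gcongr; exact exp_neg_sub_two_sq_le hk
        _ = _ := by field_simp
    have h2 : exp (-(((k + 1 : ℕ) : ℝ) ^ 2 / (2 * n) + 2 * ((k + 1 : ℕ) : ℝ) ^ 3 / n ^ 2)) ≤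
        exp (-(k / n) - 2 * (k / n) ^ 2) * exp (-(k ^ 2 / (2 * n) + 2 * k ^ 3 / n ^ 2)) := by
      rw [← exp_add]
      gcongr
      have : -(((k + 1 : ℕ) : ℝ) ^ 2 / (2 * n) + 2 * ((k + 1 : ℕ) : ℝ) ^ 3 / n ^ 2) =
          -(k / n) - 2 * (k / n) ^ 2 + -(k ^ 2 / (2 * n) + 2 * k ^ 3 / n ^ 2) -
            (1 / (2 * n) + (4 * k ^ 2 + 6 * k + 2) / n ^ 2) := by
        push_cast; field_simp; ring
      rw [this]
      have : (0 : ℝ) ≤ 1 / (2 * n) + (4 * k ^ 2 + 6 * k + 2) / n ^ 2 := by positivity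
      linarith
    rw [Nat.descFactorial_succ, Nat.cast_mul]
    calc _ ≤ (n : ℝ) ^ (k + 1) * (exp (-(k / n) - 2 * (k / n) ^ 2) *
          exp (-(k ^ 2 / (2 * n) + 2 * k ^ 3 / n ^ 2))) := by gcongr
      _ = (n * exp (-(k / n) - 2 * (k / n) ^ 2)) *
          (n ^ k * exp (-(k ^ 2 / (2 * n) + 2 * k ^ 3 / n ^ 2))) := by ring
      _ ≤ _ := mul_le_mul h1 (ih (by omega)) (by positivity) (by positivity)

/-- The forest bound with one root. The factor `k ^ 2` stands on the right to avoid the exponent `k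
- 2`. -/
theorem le_connectProb {p : ℝ} (hp0 : 0 ≤ p) (hp1 : p ≤ 1) {k : ℕ} (hk : 1 ≤ k) :
    (k : ℝ) ^ k * p ^ (k - 1) * (1 - p) ^ (k - 1).choose 2 ≤ k ^ 2 * connectProb p k := by
  obtain ⟨k, rfl⟩ := Nat.exists_eq_add_of_le' hk
  have h := le_exploreProb hp0 hp1 (k + 1) 1 k (by omega)
  simp only [one_mul, Nat.add_sub_cancel, Nat.cast_one] at h
  simp only [connectProb, Nat.add_sub_cancel]
  push_cast
  rw [add_comm (1 : ℝ)] at h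
  calc _ = ((k : ℝ) + 1) * ((k + 1) ^ k * p ^ k * (1 - p) ^ k.choose 2) := by ring
    _ ≤ (k + 1) * ((k + 1) * exploreProb p (k + 1) 1 k) := by gcongr
    _ = _ := by ring

theorem le_choose_mul_connectProb {n k : ℕ} (hk : 1 ≤ k) (h2k : 2 * k ≤ n) {p ε : ℝ}
    (hp : p = (1 + ε) / n) (hp2 : p ≤ 1 / 2) (hε : |ε| ≤ 1 / 2) (h1 : k * ε ^ 2 ≤ 2)
    (h2 : k ^ 2 * |ε| ≤ 4 * n) (h3 : (k : ℝ) ^ 3 ≤ 8 * n ^ 2) :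
    exp (-28) * n ≤
      n.choose k * (connectProb p k * (1 - p) ^ (k * (n - k))) * (k ^ 2 * √k) := by
  have hn : 0 < n := by omega
  have hn' : (0 : ℝ) < n := by exact_mod_cast hn
  have hk' : (1 : ℝ) ≤ k := by exact_mod_cast hk
  have h2k' : 2 * (k : ℝ) ≤ n := by exact_mod_cast h2k
  obtain ⟨hε1, hε2⟩ := abs_le.1 hε
  have hp0 : 0 ≤ p := by rw [hp]; exact div_nonneg (by linarith) hn'.le
  have hq0 : 0 ≤ 1 - p := by linarith
  have hpn : p * n = 1 + ε := by rw [hp]; field_simp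
  have a1 : exp ((ε - 2 * ε ^ 2) * (k - 1)) ≤ (1 + ε) ^ (k - 1) := by
    have := exp_neg_sub_two_sq_le (x := -ε) (by linarith)
    calc _ = exp (-(-ε) - 2 * (-ε) ^ 2) ^ (k - 1) := by
          rw [← exp_nat_mul, Nat.cast_sub hk]; congr 1; push_cast; ring
      _ ≤ _ := by
          refine (pow_le_pow_left₀ (exp_pos _).le this _).trans (le_of_eq ?_)
          rw [sub_neg_eq_add]
  have hE : (((k - 1).choose 2 + k * (n - k) : ℕ) : ℝ) ≤ k * n - k ^ 2 / 2 := by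
    push_cast
    rw [Nat.cast_choose_two, Nat.cast_sub hk, Nat.cast_sub (by omega)]
    push_cast
    nlinarith
  have a2 : exp (-((p + 2 * p ^ 2) * (k * n - k ^ 2 / 2))) ≤
      (1 - p) ^ ((k - 1).choose 2 + k * (n - k)) := by
    calc _ ≤ exp (-((p + 2 * p ^ 2) * ((k - 1).choose 2 + k * (n - k) : ℕ))) := by gcongr
      _ = exp (-p - 2 * p ^ 2) ^ ((k - 1).choose 2 + k * (n - k)) := by
          rw [← exp_nat_mul]; congr 1; ring
      _ ≤ _ := pow_le_pow_left₀ (exp_pos _).le (exp_neg_sub_two_sq_le hp2) _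
  have a3 := pow_mul_exp_le_descFactorial hn h2k
  have a4 := le_connectProb hp0 (by linarith) hk
  have a5 := factorial_le_exp_mul hk
  -- In the total exponent the terms k, εk and k²/(2n) cancel. What remains is at least -16 (from
  -- k³/n²), -4 (from kε²), -4 (from p²), -2 (from εk²/n) and -1/2 (from ε). The factor e in the
  -- factorial bound then turns 27 into 28.
  have hexp : exp (-27) ≤ exp (k : ℝ) * exp (-(k ^ 2 / (2 * n) + 2 * k ^ 3 / n ^ 2)) *
      exp ((ε - 2 * ε ^ 2) * (k - 1)) * exp (-((p + 2 * p ^ 2) * (k * n - k ^ 2 / 2))) := by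
    rw [← exp_add, ← exp_add, ← exp_add]
    gcongr
    have e1 : (p + 2 * p ^ 2) * (k * n - k ^ 2 / 2) =
        (1 + ε) * (k - k ^ 2 / (2 * n)) + 2 * (p * n) ^ 2 * (k / n) - p ^ 2 * k ^ 2 := by
      rw [← hpn]; field_simp; ring
    have e2 : (p * n) ^ 2 * (k / n) ≤ 4 * (1 / 2) := by
      rw [hpn]
      have : (k : ℝ) / n ≤ 1 / 2 := by
        rw [div_le_div_iff₀ hn' two_pos]; linarith
      gcongr
      nlinarith
    have e3 : (k : ℝ) ^ 3 / n ^ 2 ≤ 8 := by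
      rw [div_le_iff₀ (by positivity)]; exact h3
    have e4 : -4 ≤ ε * (k ^ 2 / n) := by
      have : |ε * (k ^ 2 / n)| ≤ 4 := by
        rw [abs_mul, abs_of_nonneg (by positivity : (0 : ℝ) ≤ k ^ 2 / n), ← mul_div_assoc,
          div_le_iff₀ hn']
        linarith
      exact (abs_le.1 this).1
    have e5 : (k : ℝ) ^ 2 / (2 * n) = k ^ 2 / n / 2 := by field_simp
    have e6 : 0 ≤ p ^ 2 * k ^ 2 := by positivity
    have e7 : 2 * (k : ℝ) ^ 3 / n ^ 2 = 2 * (k ^ 3 / n ^ 2) := by ring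
    rw [e1, e5, e7]
    nlinarith [sq_nonneg ε]
  have hch : (n.descFactorial k : ℝ) = k.factorial * n.choose k := by
    exact_mod_cast Nat.descFactorial_eq_factorial_mul_choose n k
  have hnp : (n : ℝ) ^ k * p ^ (k - 1) = n * (1 + ε) ^ (k - 1) := by
    obtain ⟨k, rfl⟩ := Nat.exists_eq_add_of_le' hk
    rw [← hpn, Nat.add_sub_cancel, mul_pow]; ring
  set D : ℝ := exp (-(k ^ 2 / (2 * n) + 2 * k ^ 3 / n ^ 2)) with hD
  set T : ℝ := n.choose k * (connectProb p k * (1 - p) ^ (k * (n - k))) with hT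
  have hc : 0 ≤ connectProb p k := exploreProb_nonneg hp0 (by linarith) _ _ _
  have hT0 : 0 ≤ T := by positivity
  have hkk : (0 : ℝ) < k ^ k := by positivity
  have hε0 : 0 ≤ 1 + ε := by linarith
  have key : (k : ℝ) ^ k * (n * D * (1 + ε) ^ (k - 1) *
      (1 - p) ^ ((k - 1).choose 2 + k * (n - k))) ≤ k.factorial * k ^ 2 * T := by
    calc _ = (n ^ k * D) * (k ^ k * p ^ (k - 1) * (1 - p) ^ (k - 1).choose 2) *
          (1 - p) ^ (k * (n - k)) := by
          rw [pow_add]; linear_combination (-(k : ℝ) ^ k * D * (1 - p) ^ (k - 1).choose 2 *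
            (1 - p) ^ (k * (n - k))) * hnp
      _ ≤ (k.factorial * n.choose k) * (k ^ 2 * connectProb p k) * (1 - p) ^ (k * (n - k)) := by
          rw [hch] at a3
          gcongr
      _ = _ := by rw [hT]; ring
  have key2 : (k : ℝ) ^ k * (n * D * exp ((ε - 2 * ε ^ 2) * (k - 1)) *
      exp (-((p + 2 * p ^ 2) * (k * n - k ^ 2 / 2)))) ≤
      (k : ℝ) ^ k * (exp 1 * √k * exp (-k) * k ^ 2 * T) := by
    calc _ ≤ (k : ℝ) ^ k * (n * D * (1 + ε) ^ (k - 1) *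
          (1 - p) ^ ((k - 1).choose 2 + k * (n - k))) := by gcongr
      _ ≤ _ := key
      _ ≤ (exp 1 * √k * (k / exp 1) ^ k) * k ^ 2 * T := by gcongr
      _ = _ := by
          rw [div_pow, ← exp_nat_mul, mul_one, exp_neg]; ring
  have key3 := le_of_mul_le_mul_left key2 hkk
  have hee : exp (k : ℝ) * exp (-k) = 1 := by rw [← exp_add]; simp
  have hee1 : exp (-28) * exp 1 = exp (-27) := by rw [← exp_add]; norm_num
  refine le_of_mul_le_mul_right ?_ (exp_pos 1)
  calc exp (-28) * n * exp 1 = n * exp (-27) := by rw [← hee1]; ring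
    _ ≤ n * (exp (k : ℝ) * D * exp ((ε - 2 * ε ^ 2) * (k - 1)) *
        exp (-((p + 2 * p ^ 2) * (k * n - k ^ 2 / 2)))) := by gcongr
    _ = exp k * (n * D * exp ((ε - 2 * ε ^ 2) * (k - 1)) *
      exp (-((p + 2 * p ^ 2) * (k * n - k ^ 2 / 2)))) := by ring
    _ ≤ exp k * (exp 1 * √k * exp (-k) * k ^ 2 * T) := by gcongr
    _ = _ := by linear_combination (exp 1 * √k * k ^ 2 * T) * hee

end Estimates

/-! ### Moments over the window of sizes, and the tail bound. -/

section Window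

open Finset Real

/-- The integers in `[b, 2b]`. -/
noncomputable def windowSizes (b : ℝ) : Finset ℕ := Icc ⌈b⌉₊ ⌊2 * b⌋₊

theorem mem_windowSizes {b : ℝ} (hb : 0 ≤ b) {k : ℕ} :
    k ∈ windowSizes b ↔ b ≤ k ∧ (k : ℝ) ≤ 2 * b := by
  rw [windowSizes, mem_Icc, Nat.ceil_le, Nat.le_floor_iff (by positivity)]

theorem le_card_windowSizes {b : ℝ} (hb : 2 ≤ b) : b / 2 ≤ #(windowSizes b) := by
  rw [windowSizes, Nat.card_Icc]
  have h1 := Nat.ceil_lt_add_one (show 0 ≤ b by linarith)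
  have h2 := Nat.lt_floor_add_one (2 * b)
  have h3 : ((⌊2 * b⌋₊ : ℝ) + 1) - ⌈b⌉₊ ≤ ((⌊2 * b⌋₊ + 1 - ⌈b⌉₊ : ℕ) : ℝ) := by
    rw [sub_le_iff_le_add]
    exact_mod_cast (by omega : ⌊2 * b⌋₊ + 1 ≤ ⌊2 * b⌋₊ + 1 - ⌈b⌉₊ + ⌈b⌉₊)
  linarith

/-- A lower bound for the expected number of components with size in `[β ^ 2, 2 β ^ 2]`. -/
theorem sum_window_ge {n : ℕ} {β ν ε p : ℝ} (hn : ν ^ 3 = n) (hβ : 2 ≤ β ^ 2) (hβ0 : 0 < β)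
    (hβν : β ≤ ν) (hεβ : |ε| * β ≤ 1) (hε : |ε| ≤ 1 / 2) (hp : p = (1 + ε) / n) (hp0 : 0 ≤ p)
    (hp2 : p ≤ 1 / 2) (hW4 : ∀ k ∈ windowSizes (β ^ 2), 4 * k ≤ n) :
    exp (-28) / 16 * (n / β ^ 3) ≤ ∑ k ∈ windowSizes (β ^ 2),
      n.choose k * (connectProb p k * (1 - p) ^ (k * (n - k))) := by
  have hν0 : 0 < ν := by linarith
  have hn' : (0 : ℝ) < n := by rw [← hn]; positivity
  -- Here 8β⁵ = (2β²)² · 2β bounds `k ^ 2 * √k` on the window. At least β²/2 such terms yield the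
  -- constant 1/16.
  have hterm : ∀ k ∈ windowSizes (β ^ 2), exp (-28) * n / (8 * β ^ 5) ≤
      n.choose k * (connectProb p k * (1 - p) ^ (k * (n - k))) := by
    intro k hk
    obtain ⟨hk1, hk2⟩ := (mem_windowSizes (by positivity)).1 hk
    have hkpos : 1 ≤ k := by
      exact_mod_cast (by linarith : (1 : ℝ) ≤ k)
    have h := le_choose_mul_connectProb (p := p) (ε := ε) hkpos
      (by have := hW4 k hk; omega : 2 * k ≤ n) hp hp2 hε ?_ ?_ ?_
    · have hc : 0 ≤ connectProb p k := exploreProb_nonneg hp0 (by linarith) _ _ _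
      have hq0 : 0 ≤ 1 - p := by linarith
      have hsq : √k ≤ 2 * β := by
        rw [sqrt_le_left (by positivity)]
        nlinarith
      rw [div_le_iff₀ (by positivity)]
      refine h.trans ?_
      have : (k : ℝ) ^ 2 * √k ≤ 8 * β ^ 5 := by
        calc _ ≤ (2 * β ^ 2) ^ 2 * (2 * β) := by gcongr
          _ = _ := by ring
      gcongr
    · calc (k : ℝ) * ε ^ 2 ≤ 2 * β ^ 2 * ε ^ 2 := by gcongr
        _ = 2 * (|ε| * β) ^ 2 := by rw [mul_pow, sq_abs]; ring
        _ ≤ 2 * 1 ^ 2 := by gcongr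
        _ = 2 := by norm_num
    · calc (k : ℝ) ^ 2 * |ε| ≤ (2 * β ^ 2) ^ 2 * |ε| := by gcongr
        _ = 4 * β ^ 3 * (|ε| * β) := by ring
        _ ≤ 4 * β ^ 3 * 1 := by gcongr
        _ ≤ 4 * n := by
          rw [← hn, mul_one]
          gcongr
    · calc (k : ℝ) ^ 3 ≤ (2 * β ^ 2) ^ 3 := by gcongr
        _ = 8 * (β ^ 3) ^ 2 := by ring
        _ ≤ 8 * (ν ^ 3) ^ 2 := by
          gcongr
        _ = _ := by rw [hn]
  calc exp (-28) / 16 * (n / β ^ 3) = β ^ 2 / 2 * (exp (-28) * n / (8 * β ^ 5)) := by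
        field_simp; norm_num
    _ ≤ #(windowSizes (β ^ 2)) * (exp (-28) * n / (8 * β ^ 5)) := by
        have := le_card_windowSizes hβ
        gcongr
    _ ≤ _ := by
        rw [← nsmul_eq_mul]
        exact card_nsmul_le_sum _ _ _ hterm

/-- After 1/n cancels, the exponent is jk(ε/n + 2p²) with jk ≤ 4β⁴. One factor β is absorbed by |ε|β
≤ 1, leaving order β³/n. -/
theorem window_exponent_le {n j k : ℕ} {β ν ε p : ℝ} (hn : ν ^ 3 = n) (hν : 1 ≤ ν) (hβ0 : 0 < β)
    (hβν : β ≤ ν) (hεβ : |ε| * β ≤ 1) (hp : p = (1 + ε) / n) (hp0 : 0 ≤ p) (hp2 : p ≤ 2 / n)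
    (hj : (j : ℝ) ≤ 2 * β ^ 2) (hk : (k : ℝ) ≤ 2 * β ^ 2) :
    j * k * (p + 2 * p ^ 2 - 1 / n) ≤ 36 * (β ^ 3 / n) := by
  have hn' : (0 : ℝ) < n := by rw [← hn]; positivity
  have e1 : p + 2 * p ^ 2 - 1 / n = ε / n + 2 * p ^ 2 := by rw [hp]; ring
  have e2 : ε / n + 2 * p ^ 2 ≤ |ε| / n + 8 / n ^ 2 := by
    have : p ^ 2 ≤ (2 / n) ^ 2 := by gcongr
    rw [div_pow] at this
    have h := le_abs_self ε
    have : ε / n ≤ |ε| / n := by gcongr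
    linarith [(by ring : 2 * ((2 : ℝ) ^ 2 / n ^ 2) = 8 / n ^ 2)]
  rw [e1]
  calc (j : ℝ) * k * (ε / n + 2 * p ^ 2) ≤ (j : ℝ) * k * (|ε| / n + 8 / n ^ 2) := by gcongr
    _ ≤ (2 * β ^ 2) * (2 * β ^ 2) * (|ε| / n + 8 / n ^ 2) := by
      gcongr
    _ = 4 * (β ^ 3 / n) * (|ε| * β) + 32 * (β ^ 3 / n) * (β / n) := by field_simp; ring
    _ ≤ 4 * (β ^ 3 / n) * 1 + 32 * (β ^ 3 / n) * 1 := by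
      have : β / n ≤ 1 := by
        rw [div_le_one hn', ← hn]
        nlinarith [sq_nonneg ν]
      gcongr
    _ = _ := by ring

/-- The lower tail bound, with `b = β ^ 2` and `n = ν ^ 3`. -/
theorem binomialRandom_lower_tail {n : ℕ} {β ν γ l : ℝ} (hn : ν ^ 3 = n) (hβ : 2 ≤ β ^ 2)
    (hβ0 : 0 < β) (hγ : 5 ≤ γ) (hγν : 2 * γ ≤ ν) (hl : |l| ≤ γ) (hβγ : β * γ ≤ ν)
    (p : unitInterval) (hp : (p : ℝ) = (1 + l / ν) / n) :
    (SimpleGraph.binomialRandom (Fin n) p).real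
      {G : SimpleGraph (Fin n) | ((componentsInWindow G (β ^ 2)).ncard : ℝ) ≤
        exp (-28) / 32 * (n / β ^ 3)} ≤ (64 * exp 28 + 288) * (β ^ 3 / n) := by
  classical
  have hν : 10 ≤ ν := by linarith
  have hν0 : 0 < ν := by linarith
  have hγ0 : 0 < γ := by linarith
  have hn' : (0 : ℝ) < n := by rw [← hn]; positivity
  have hn0 : 0 < n := by exact_mod_cast hn'
  set ε := l / ν with hεdef
  have hεν : |ε| * ν ≤ γ := by
    rw [hεdef, abs_div, abs_of_pos hν0, div_mul_cancel₀ _ hν0.ne']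
    exact hl
  have hε : |ε| ≤ 1 / 2 := by
    by_contra! h
    nlinarith
  have hεβ : |ε| * β ≤ 1 := by
    by_contra! h
    nlinarith [abs_nonneg ε]
  -- The requirement `5 ≤ γ` makes β³/n at most 1/125, so that 36β³/n ≤ 1/2 and the exponential can
  -- be linearized.
  have hβν : β ≤ ν / 5 := by nlinarith
  have hβν' : β ≤ ν := by linarith
  obtain ⟨hε1, hε2⟩ := abs_le.1 hε
  have hp0 := p.2.1
  have hp1 := p.2.2
  have hpn : (p : ℝ) * n = 1 + ε := by rw [hp]; field_simp
  have hn1000 : (1000 : ℝ) ≤ n := by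
    rw [← hn]
    calc (1000 : ℝ) = 10 ^ 3 := by norm_num
      _ ≤ ν ^ 3 := by gcongr
  have hp2 : (p : ℝ) ≤ 2 / n := by rw [le_div_iff₀ hn']; linarith
  have hp2' : (p : ℝ) ≤ 1 / 2 := by
    refine hp2.trans ?_
    rw [div_le_div_iff₀ hn' two_pos]; linarith
  set b := β ^ 3 / n with hb
  have hb0 : 0 < b := by positivity
  have hb1 : 125 * b ≤ 1 := by
    have : β ^ 3 ≤ (ν / 5) ^ 3 := by gcongr
    rw [hb, ← mul_div_assoc, div_le_one hn', ← hn]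
    linarith [this, (by ring : (ν / 5) ^ 3 = ν ^ 3 / 125)]
  have hW : ∀ k ∈ windowSizes (β ^ 2), β ^ 2 ≤ k ∧ (k : ℝ) ≤ 2 * β ^ 2 := fun k hk =>
    (mem_windowSizes (by positivity)).1 hk
  have hW0 : 0 ∉ windowSizes (β ^ 2) := by
    intro h
    have := (hW 0 h).1
    norm_num at this
    linarith
  have h8 : 8 * β ^ 2 ≤ n := by
    have : β ^ 2 ≤ (ν / 5) ^ 2 := by gcongr
    rw [← hn]
    nlinarith [sq_nonneg ν]
  have hW4 : ∀ k ∈ windowSizes (β ^ 2), 4 * k ≤ n := by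
    intro k hk
    have := (hW k hk).2
    exact_mod_cast (by linarith : 4 * (k : ℝ) ≤ n)
  obtain ⟨r, hr⟩ : ∃ r : Finset (Fin n) → Fin n, ∀ A : Finset (Fin n), A.Nonempty → r A ∈ A :=
    ⟨fun A => if h : A.Nonempty then h.choose else ⟨0, hn0⟩, fun A h => by
      simp only [h, dif_pos]; exact h.choose_spec⟩
  set Y := componentCount r (windowSizes (β ^ 2)) with hY
  set M := bernSum p (edgeSlots (Fin n)) Y with hM
  have hMlow : exp (-28) / 16 * (n / β ^ 3) ≤ M := by
    rw [hM, hY, bernSum_componentCount hr hW0, Fintype.card_fin,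
      sum_card_mem n (Fintype.card_fin n) _ (fun k hk => by have := hW4 k hk; omega)
        (fun k => connectProb p k * (1 - p) ^ (k * (n - k)))]
    exact sum_window_ge hn hβ hβ0 hβν' hεβ hε hp hp0 hp2' hW4
  have hM0 : 0 < M := lt_of_lt_of_le (by positivity) hMlow
  have hsq : bernSum p (edgeSlots (Fin n)) (fun s => Y s ^ 2) ≤ M + (1 + 72 * b) * M ^ 2 := by
    refine bernSum_componentCount_sq_le hr hW0 hp0 hp1 n (Fintype.card_fin n)
      (fun k hk => by have := hW4 k hk; omega) fun j hj k hk => ?_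
    have hq0 : 0 ≤ 1 - (p : ℝ) := sub_nonneg.2 hp1
    refine (choose_sub_mul_pow_le (by have := hW4 k hk; have := hW4 j hj; omega) hn0 hp2').trans ?_
    refine mul_le_mul_of_nonneg_right ?_ (by positivity)
    have h36 : (j : ℝ) * k * (p + 2 * p ^ 2 - 1 / n) ≤ 36 * b :=
      window_exponent_le hn (by linarith) hβ0 hβν' hεβ hp hp0 hp2 (hW j hj).2 (hW k hk).2
    calc exp (j * k * (p + 2 * p ^ 2 - 1 / n)) ≤ exp (36 * b) := by gcongr
      _ ≤ 1 + 2 * (36 * b) := exp_le_one_add_two_mul (by positivity) (by linarith)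
      _ = _ := by ring
  -- The final constant is 4(1/M + 72b) with 1/M ≤ 16 e²⁸ b. The threshold e⁻²⁸/32 is half the
  -- constant in the lower bound for `M`.
  have htail := bernSum_lower_tail hp0 hp1 hM.symm hM0 hsq
  rw [binomialRandom_real_eq]
  refine (bernSum_mono hp0 hp1 fun s _ => ?_).trans (htail.trans ?_)
  · have hle := componentCount_le hr (by positivity) hW s
    have himp : ((componentsInWindow (SimpleGraph.fromEdgeSet (s : Set (Sym2 (Fin n))))
        (β ^ 2)).ncard : ℝ) ≤ exp (-28) / 32 * (n / β ^ 3) → Y s ≤ M / 2 := by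
      intro h
      linarith
    split_ifs with h h'
    · exact le_rfl
    · exact absurd (himp h) h'
    · exact zero_le_one
    · exact le_rfl
  · have : 1 / M ≤ 16 * exp 28 * b := by
      rw [div_le_iff₀ hM0]
      calc (1 : ℝ) = 16 * exp 28 * b * (exp (-28) / 16 * (n / β ^ 3)) := by
            rw [hb, exp_neg]; field_simp
        _ ≤ _ := by gcongr
    linarith

end Window

/-! ### The theorem, for all n. -/

theorem mainTheorem8
    (g lam B : ℕ → ℝ)
    (hg_pos : ∀ n, 0 < g n)
    (hg_mono : Monotone g)
    (hg_tendsto : Tendsto g atTop atTop)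
    (hg_small : g =o[atTop] fun n : ℕ => (n : ℝ) ^ (1 / 3 : ℝ))
    (hlam : ∀ n, 1 ≤ n → |lam n| ≤ g n)
    (hB : ∀ n, 1 ≤ n → B n ≤ (n : ℝ) ^ (2 / 3 : ℝ) / g n ^ 2)
    (hB_tendsto : Tendsto B atTop atTop) :
    ∃ δ₁ δ₂ : ℝ, 0 < δ₁ ∧ 0 < δ₂ ∧
      ∀ n : ℕ, 1 ≤ n → 0 < B n →
        ∀ hp : criticalEdgeProb n (lam n) ∈ unitInterval,
          (SimpleGraph.binomialRandom (Fin n) ⟨criticalEdgeProb n (lam n), hp⟩).real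
              {G : SimpleGraph (Fin n) |
                ((componentsInWindow G (B n)).ncard : ℝ) ≤ δ₁ * n / B n ^ (3 / 2 : ℝ)}
            ≤ δ₂ * B n ^ (3 / 2 : ℝ) / n := by
  obtain ⟨N, hN⟩ := eventually_atTop.1 (((hg_tendsto.eventually_ge_atTop 5).and
    (hB_tendsto.eventually_ge_atTop 2)).and (hg_small.def (show (0 : ℝ) < 1 / 2 by norm_num)))
  -- Adding `S` to the second constant makes the bound at least 1, hence trivial, for each of the
  -- finitely many n below `N`.
  set S : ℝ := ∑ m ∈ Finset.range N, |m / B m ^ (3 / 2 : ℝ)| with hS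
  have hS0 : 0 ≤ S := Finset.sum_nonneg fun _ _ => abs_nonneg _
  refine ⟨Real.exp (-28) / 32, 64 * Real.exp 28 + 288 + S, by positivity, by positivity, ?_⟩
  intro n hn1 hBn hp
  have hn' : (0 : ℝ) < n := by exact_mod_cast hn1
  have hB32 : 0 < B n ^ (3 / 2 : ℝ) := by positivity
  rcases lt_or_ge n N with hnN | hnN
  · refine measureReal_le_one.trans ?_
    rw [le_div_iff₀ hn', one_mul, ← div_le_iff₀ hB32]
    have h1 : |(n : ℝ) / B n ^ (3 / 2 : ℝ)| ≤ S :=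
      Finset.single_le_sum (f := fun m : ℕ => |(m : ℝ) / B m ^ (3 / 2 : ℝ)|)
        (fun _ _ => abs_nonneg _) (Finset.mem_range.2 hnN)
    have h2 := le_abs_self ((n : ℝ) / B n ^ (3 / 2 : ℝ))
    have := Real.exp_pos 28
    linarith
  · obtain ⟨⟨hg5, hB2⟩, hgs⟩ := hN n hnN
    -- With n = ν³ and B(n) = β², every real power becomes an integer power, and the hypothesis on
    -- `B` reads βg(n) ≤ ν.
    set ν : ℝ := (n : ℝ) ^ (1 / 3 : ℝ) with hν
    set β : ℝ := √(B n) with hβ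
    have hν0 : 0 < ν := by positivity
    have hβ0 : 0 < β := Real.sqrt_pos.2 hBn
    have hβ2 : β ^ 2 = B n := Real.sq_sqrt hBn.le
    have hν3 : ν ^ 3 = n := by
      rw [hν, ← Real.rpow_natCast, ← Real.rpow_mul hn'.le]; norm_num
    have hν2 : (n : ℝ) ^ (2 / 3 : ℝ) = ν ^ 2 := by
      rw [hν, ← Real.rpow_natCast, ← Real.rpow_mul hn'.le]; norm_num
    have hν1 : (n : ℝ) ^ (-(1 / 3) : ℝ) = ν⁻¹ := by rw [hν, Real.rpow_neg hn'.le]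
    have hβ3 : B n ^ (3 / 2 : ℝ) = β ^ 3 := by
      rw [hβ, Real.sqrt_eq_rpow, ← Real.rpow_natCast, ← Real.rpow_mul hBn.le]; norm_num
    have hgν : 2 * g n ≤ ν := by
      rw [Real.norm_of_nonneg (hg_pos n).le, Real.norm_of_nonneg hν0.le] at hgs
      linarith
    have hβg : β * g n ≤ ν := by
      have h := hB n hn1
      rw [hν2, le_div_iff₀ (pow_pos (hg_pos n) 2), ← hβ2, ← mul_pow] at h
      exact le_of_sq_le_sq h hν0.le
    have h := binomialRandom_lower_tail (l := lam n) hν3 (hβ2 ▸ hB2) hβ0 hg5 hgν (hlam n hn1) hβg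
      ⟨criticalEdgeProb n (lam n), hp⟩
      (by simp only [criticalEdgeProb, hν1, div_eq_mul_inv (lam n)])
    rw [hβ2] at h
    rw [hβ3]
    simp only [mul_div_assoc]
    refine h.trans ?_
    refine mul_le_mul_of_nonneg_right ?_ (by positivity)
    linarith
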